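/- Let $k$ be a field and let $d \ge 1$ and $d'$ be integers with $d+2 \le d' \le 2d+1$. Write $\dim$ for Krull dimension, and for an $\mathbb{N}$-graded ring $R$ let $\dim^{\mathrm{gr}}(R)$ be the supremum of the lengths $r$ of chains $\mathfrak p_0 \subsetneq \cdots \subsetneq \mathfrak p_r$ of homogeneous prime ideals of $R$. An $\mathbb{N}$-graded ring $R=\bigoplus_{n\ge 0}R_n$ with $R_0=k$ is called a Hilbert–Serre ring if $\dim_k R_n<\infty$ for all $n$, its Poincaré series $P_R(t)=\sum_{n\ge 0}(\dim_k R_n)t^n$ has radius of convergence $1$, and for some $e\in\mathbb{N}$ the limit $\lim_{t\to 1^-}(1-t)^eP_R(t)$ exists and is finite. (a) There is an integral domain $A$ containing $k$ with $\dim(A)=d$ and $\dim(A[x])=d'$. (b) For every integral domain $A$ containing $k$ with $\dim(A)=d$ and $\dim(A[x])=d'$, let $R=k\oplus\bigoplus_{n>0}Ax^n\subseteq A[x]$, graded by $R_0=k$ and $R_n=Ax^n$ for $n>0$. Then $R$ is a graded integral domain with $R_0=k$ that is not a Hilbert–Serre ring, and $$\dim^{\mathrm{gr}}(R)=d+1<d'=\dim(R).$$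 In particular, the graded Krull dimension of $R$ is strictly smaller than its Krull dimension. -/

import Mathlib

open Polynomial Topology

universe u v

noncomputable section

/-- The graded Krull dimension: the supremum of the lengths of chains of homogeneous prime
ideals. -/
def gradedKrullDim {k : Type u} {R : Type v} [CommRing k] [CommRing R] [Algebra k R]
    (𝒜 : ℕ → Submodule k R) [GradedAlgebra 𝒜] : WithBot ℕ∞ :=
  Order.krullDim {p : PrimeSpectrum R // p.asIdeal.IsHomogeneous 𝒜}

/-- The value at `t` of the Poincaré series `∑ (dim_k R_n) t ^ n`. -/
def poincareSeries {k : Type u} {R : Type v} [Field k] [CommRing R] [Algebra k R]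
    (𝒜 : ℕ → Submodule k R) (t : ℝ) : ℝ :=
  ∑' n : ℕ, (Module.finrank k (𝒜 n) : ℝ) * t ^ n

/-- Hilbert-Serre rings, among the `ℕ`-graded `k`-algebras with `R_0 = k` a field. -/
structure IsHilbertSerre {k : Type u} {R : Type v} [Field k] [CommRing R] [Algebra k R]
    (𝒜 : ℕ → Submodule k R) [GradedAlgebra 𝒜] : Prop where
  /-- Each graded piece is finite-dimensional. -/
  finite : ∀ n, Module.Finite k (𝒜 n)
  /-- The Poincaré series has radius of convergence `1`. -/
  radius_eq_one :
    (FormalMultilinearSeries.ofScalars ℝ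
      (fun n => (Module.finrank k (𝒜 n) : ℝ))).radius = 1
  /-- For some `d`, the limit of `(1 - t) ^ d * P_R(t)` as `t → 1-` exists and is finite. -/
  exists_pole_order : ∃ (d : ℕ) (l : ℝ),
    Filter.Tendsto (fun t : ℝ => (1 - t) ^ d * poincareSeries 𝒜 t) (𝓝[<] 1) (𝓝 l)

/-- The ring `k ⊕ ⨁_{n > 0} A x ^ n` of the polynomials over `A` whose constant coefficient lies
in `k`, as a `k`-subalgebra of `A[x]`. -/
def constRing (k : Type u) (A : Type v) [Field k] [CommRing A] [Algebra k A] :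
    Subalgebra k A[X] where
  carrier := {f | f.coeff 0 ∈ (algebraMap k A).range}
  mul_mem' {f g} hf hg := by
    simp only [Set.mem_ofPred_eq, mul_coeff_zero] at *
    exact mul_mem hf hg
  add_mem' {f g} hf hg := by
    simp only [Set.mem_ofPred_eq, coeff_add] at *
    exact add_mem hf hg
  algebraMap_mem' c := ⟨c, by simp [Polynomial.algebraMap_apply]⟩

/-- The degree `n` part of `k ⊕ ⨁_{n > 0} A x ^ n`: its elements of the form `a x ^ n`. This is
`k` for `n = 0` and `A x ^ n` for `n > 0`, see `mem_constGrading_zero` and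
`mem_constGrading_pos`. -/
def constGrading (k : Type u) (A : Type v) [Field k] [CommRing A] [Algebra k A] (n : ℕ) :
    Submodule k (constRing k A) where
  carrier := {f | ∃ a : A, (f : A[X]) = monomial n a}
  add_mem' := by
    rintro f g ⟨a, ha⟩ ⟨b, hb⟩
    exact ⟨a + b, by rw [map_add, ← ha, ← hb]; rfl⟩
  zero_mem' := ⟨0, by simp⟩
  smul_mem' := by
    rintro c f ⟨a, ha⟩
    exact ⟨c • a, by rw [← smul_monomial, ← ha]; rfl⟩

section

variable {k : Type u} {A : Type v} [Field k] [CommRing A] [Algebra k A]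

theorem mem_constGrading {n : ℕ} {f : constRing k A} :
    f ∈ constGrading k A n ↔ ∃ a : A, (f : A[X]) = monomial n a := Iff.rfl

theorem mem_constGrading_zero {f : constRing k A} :
    f ∈ constGrading k A 0 ↔ ∃ c : k, f = algebraMap k (constRing k A) c := by
  constructor
  · rintro ⟨a, ha⟩
    obtain ⟨c, hc⟩ := f.2
    refine ⟨c, Subtype.ext ?_⟩
    rw [ha] at hc
    rw [ha]
    have h : algebraMap k A c = a := by simpa using hc
    rw [← h]
    rfl
  · rintro ⟨c, rfl⟩
    exact ⟨algebraMap k A c, rfl⟩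

theorem monomial_mem_constRing {n : ℕ} (hn : 0 < n) (a : A) :
    monomial n a ∈ constRing k A :=
  ⟨0, by simp [coeff_monomial, hn.ne']⟩

theorem mem_constGrading_pos {n : ℕ} (hn : 0 < n) {f : constRing k A} :
    f ∈ constGrading k A n ↔ ∃ a : A, f = ⟨monomial n a, monomial_mem_constRing hn a⟩ := by
  simp only [mem_constGrading, Subtype.ext_iff]

/-- The homogeneous component of degree `n`. -/
def constComponent (n : ℕ) (f : constRing k A) : constGrading k A n :=
  ⟨⟨monomial n ((f : A[X]).coeff n), by
    rcases Nat.eq_zero_or_pos n with rfl | hn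
    · obtain ⟨c, hc⟩ := f.2
      exact ⟨c, by simp [hc]⟩
    · exact monomial_mem_constRing hn _⟩, _, rfl⟩

theorem coeff_coeAddMonoidHom_constGrading
    (x : DirectSum ℕ fun n => constGrading k A n) (n : ℕ) :
    ((DirectSum.coeAddMonoidHom (constGrading k A) x : constRing k A) : A[X]).coeff n =
      ((x n : constRing k A) : A[X]).coeff n := by
  induction x using DirectSum.induction_on with
  | zero => simp
  | of i y =>
    obtain ⟨a, ha⟩ := y.2
    rw [DirectSum.coeAddMonoidHom_of]
    by_cases h : i = n
    · subst h
      rw [DirectSum.of_eq_same]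
    · rw [DirectSum.of_eq_of_ne _ _ _ (Ne.symm h), ha, coeff_monomial, if_neg h]
      simp
  | add x y hx hy => simp [hx, hy]

/-- `k ⊕ ⨁_{n > 0} A x ^ n` is a graded `k`-algebra. -/
instance constGradedAlgebra : GradedAlgebra (constGrading k A) where
  one_mem := ⟨1, by simp⟩
  mul_mem := by
    rintro i j f g ⟨a, ha⟩ ⟨b, hb⟩
    exact ⟨a * b, by simp [ha, hb, monomial_mul_monomial]⟩
  decompose' f := DirectSum.mk (fun n => constGrading k A n) (f : A[X]).support
    fun n => constComponent n f
  left_inv f := by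
    apply Subtype.ext
    ext n
    rw [coeff_coeAddMonoidHom_constGrading]
    by_cases hn : n ∈ (f : A[X]).support
    · rw [DirectSum.mk_apply_of_mem hn]
      simp [constComponent]
    · rw [DirectSum.mk_apply_of_notMem hn, notMem_support_iff.mp hn]
      simp
  right_inv x := by
    apply DFinsupp.ext
    intro n
    have key := coeff_coeAddMonoidHom_constGrading x n
    obtain ⟨a, ha⟩ := (x n).2
    apply Subtype.ext
    apply Subtype.ext
    by_cases hn : n ∈ ((DirectSum.coeAddMonoidHom (constGrading k A) x :
        constRing k A) : A[X]).support
    · rw [DirectSum.mk_apply_of_mem hn]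
      simp [constComponent, key, ha]
    · rw [DirectSum.mk_apply_of_notMem hn]
      rw [notMem_support_iff, key, ha] at hn
      rw [ha]
      have h : a = 0 := by simpa using hn
      simp [h]

end

end

/-! Part (a) is Seidenberg's construction. For a domain `D` inside a field `L` with an element `s`
transcendental over `D`, the ring `D ×_L L⟦X⟧` has spectrum Spec `D` with a new generic point, so
its dimension is one larger. The dimension of its polynomial ring grows by two, because the kernel
of evaluation at `s` fits between zero and the copy of Spec `D[X]`. Iterating from a polynomial ring
over `k` reaches every admissible pair.

For (b), `R` and `A[X]` agree after inverting `x`, and the irrelevant ideal is the only prime of `R`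
containing `x`. Chains of primes avoiding `x` therefore transfer both ways, with an adjustment at
the top, and `dim R = dim A[X]`. Homogeneous primes avoiding `x` come from primes of `A`, so with
the irrelevant ideal on top the graded dimension is `dim A + 1`. Hilbert–Serre fails already in
degree 1, where the graded piece is a copy of `A`. -/

section Order

/-! ### Adjoining one or two levels below an ordered set -/

variable {P : Type*} [PartialOrder P]

theorem krullDim_eq_add_one_of_forall_eq_or_mem (s : Set P) (hs : s.Nonempty) (b : P)
    (hb : ∀ p ∈ s, b < p) (h : ∀ p ∉ s, p = b) :
    Order.krullDim P = Order.krullDim s + 1 := by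
  classical
  have : Nonempty s := hs.to_subtype
  have hbs : b ∉ s := fun hb' => lt_irrefl _ (hb b hb')
  rw [← Order.krullDim_withBot]
  apply le_antisymm
  · refine Order.krullDim_le_of_strictMono
      (fun p => if hp : p ∈ s then ((⟨p, hp⟩ : s) : WithBot s) else ⊥) fun p q hpq => ?_
    have hq : q ∈ s := by
      by_contra hq
      obtain rfl := h q hq
      by_cases hp : p ∈ s
      · exact lt_asymm hpq (hb p hp)
      · exact hpq.ne (h p hp)
    by_cases hp : p ∈ s
    · simpa [hp, hq] using hpq
    · simp [hp, hq]
  · refine Order.krullDim_le_of_strictMono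
      (fun p : WithBot s => p.recBotCoe b (fun p => (p : P))) fun p q hpq => ?_
    induction q with
    | bot => simp at hpq
    | coe q =>
      induction p with
      | bot => exact hb q q.2
      | coe p => simpa using hpq

/-- Elements outside `s` other than `b` are pairwise incomparable by `h`, so they collapse to a
single level, which `c` shows to be occupied below all of `s`. -/
theorem krullDim_eq_add_two_of_lt_of_lt (s : Set P) (hs : s.Nonempty) (hup : IsUpperSet s)
    (b c : P) (hbc : b < c) (hb : ∀ p, b ≤ p) (hc : ∀ p ∈ s, c < p)
    (h : ∀ p q, q ∉ s → p < q → p = b) :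
    Order.krullDim P = Order.krullDim s + 2 := by
  classical
  have : Nonempty s := hs.to_subtype
  have hcs : c ∉ s := fun hc' => lt_irrefl _ (hc c hc')
  have hbs : b ∉ s := fun hb' => lt_asymm hbc (hc b hb')
  have key : Order.krullDim (WithBot (WithBot s)) = Order.krullDim s + 2 := by
    rw [Order.krullDim_withBot, Order.krullDim_withBot, add_assoc, one_add_one_eq_two]
  rw [← key]
  apply le_antisymm
  · refine Order.krullDim_le_of_strictMono
      (fun p => if hp : p ∈ s then (((⟨p, hp⟩ : s) : WithBot s) : WithBot (WithBot s))
        else if p = b then ⊥ else ((⊥ : WithBot s) : WithBot (WithBot s))) fun p q hpq => ?_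
    have hqb : q ≠ b := fun hq => (hq ▸ hpq).not_ge (hb p)
    by_cases hp : p ∈ s
    · have hq : q ∈ s := hup hpq.le hp
      simpa [hp, hq] using hpq
    · by_cases hq : q ∈ s
      · by_cases hpb : p = b
        · simp [hq, hpb, hbs]
        · simp [hp, hq, hpb]
      · simp [h p q hq hpq, hbs, hq, hqb]
  · refine Order.krullDim_le_of_strictMono
      (fun p : WithBot (WithBot s) => p.recBotCoe b
        (fun p => p.recBotCoe c (fun p => (p : P)))) fun p q hpq => ?_
    induction q with
    | bot => simp at hpq
    | coe q =>
      induction p with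
      | bot =>
        induction q with
        | bot => exact hbc
        | coe q => exact hbc.trans (hc q q.2)
      | coe p =>
        rw [WithBot.coe_lt_coe] at hpq
        induction q with
        | bot => simp at hpq
        | coe q =>
          induction p with
          | bot => exact hc q q.2
          | coe p => simpa using hpq

end Order

/-! ### Closed subsets of spectra and the generic fibre of a polynomial ring -/

theorem krullDim_zeroLocus_ker_of_surjective {R S : Type*} [CommRing R] [CommRing S]
    (f : R →+* S) (hf : Function.Surjective f) :
    Order.krullDim (PrimeSpectrum.zeroLocus (RingHom.ker f : Set R)) = ringKrullDim S := by
  rw [← ringKrullDim_quotient,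
    ringKrullDim_eq_of_ringEquiv (RingHom.quotientKerEquivOfSurjective hf)]

theorem zeroLocus_ker_nonempty {R S : Type*} [CommRing R] [CommRing S] [Nontrivial S]
    (f : R →+* S) : (PrimeSpectrum.zeroLocus (RingHom.ker f : Set R)).Nonempty := by
  obtain ⟨M, hM, hle⟩ := Ideal.exists_le_maximal _ (RingHom.ker_ne_top f)
  exact ⟨⟨M, hM.isPrime⟩, hle⟩

/-- A prime of `A[X]` lying strictly below a prime with zero contraction is zero. -/
theorem Polynomial.eq_bot_of_lt_of_comap_C_eq_bot {A : Type*} [CommRing A] [IsDomain A]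
    (p q : PrimeSpectrum A[X]) (hpq : p < q) (hq : q.comap C = ⊥) : p = ⊥ := by
  have hp : p.comap C = ⊥ := le_bot_iff.mp (hq ▸ Ideal.comap_mono hpq.le)
  have hbot : (⊥ : PrimeSpectrum A[X]).comap C = ⊥ :=
    le_bot_iff.mp (hp ▸ Ideal.comap_mono (bot_le (a := p)))
  -- The fibre over zero is the spectrum of a polynomial ring in one variable over a field, too
  -- short for `⊥ < p < q`.
  have hdim : Order.krullDim (PrimeSpectrum.comap (algebraMap A A[X]) ⁻¹' {⊥}) ≤ 1 := by
    rw [Order.krullDim_eq_of_orderIso (PrimeSpectrum.preimageOrderIsoFiber A A[X] ⊥),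
      ← ringKrullDim, ← ringKrullDim_eq_of_ringEquiv
        (polyEquivTensor A ((⊥ : PrimeSpectrum A).asIdeal.ResidueField)).toRingEquiv]
    exact Ring.krullDimLE_iff.mp inferInstance
  rw [Order.krullDim_le_one_iff] at hdim
  rcases hdim ⟨p, hp⟩ with h | h
  · exact le_bot_iff.mp (h (b := ⟨⊥, hbot⟩) (bot_le (a := p)))
  · exact absurd (h (b := ⟨q, hq⟩) hpq.le) hpq.not_ge

/-! ### The pullback `D ×_L L⟦X⟧` and its polynomial ring -/

noncomputable section Pullback

variable (D L : Type u) [CommRing D] [Field L] [Algebra D L]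

/-- The pullback `D ×_L L⟦X⟧`: the power series over `L` whose constant coefficient comes with a
lift to `D`. -/
abbrev powerSeriesPullback : Subring (D × PowerSeries L) :=
  RingHom.eqLocus ((algebraMap D L).comp (RingHom.fst D (PowerSeries L)))
    ((PowerSeries.constantCoeff (R := L)).comp (RingHom.snd D (PowerSeries L)))

namespace powerSeriesPullback

/-- The projection to `D`. -/
def toBase : powerSeriesPullback D L →+* D :=
  (RingHom.fst D (PowerSeries L)).comp (powerSeriesPullback D L).subtype

/-- The projection to the power series. -/
def toSeries : powerSeriesPullback D L →+* PowerSeries L :=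
  (RingHom.snd D (PowerSeries L)).comp (powerSeriesPullback D L).subtype

variable {D L}

theorem algebraMap_toBase (a : powerSeriesPullback D L) :
    algebraMap D L (toBase D L a) = PowerSeries.constantCoeff (toSeries D L a) := a.2

/-- The element of the pullback given by the power series `X * g`. -/
def ofXMul (g : PowerSeries L) : powerSeriesPullback D L :=
  ⟨(0, PowerSeries.X * g), by simp [RingHom.mem_eqLocus]⟩

@[simp]
theorem toBase_ofXMul (g : PowerSeries L) : toBase D L (ofXMul g) = 0 := rfl

@[simp]
theorem toSeries_ofXMul (g : PowerSeries L) :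
    toSeries D L (ofXMul g) = PowerSeries.X * g := rfl

variable (D L) in
/-- The inclusion of the base ring as the constant power series. -/
def ofBase : D →+* powerSeriesPullback D L :=
  (RingHom.prod (RingHom.id D) ((PowerSeries.C (R := L)).comp (algebraMap D L))).codRestrict _
    fun d => by simp [RingHom.mem_eqLocus]

theorem toBase_surjective : Function.Surjective (toBase D L) := fun d => ⟨ofBase D L d, rfl⟩

theorem ofXMul_one_ne_zero : (ofXMul 1 : powerSeriesPullback D L) ≠ 0 := fun h => by
  have := congrArg (toSeries D L) h
  simp [PowerSeries.X_ne_zero] at this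

variable [FaithfulSMul D L]

theorem toSeries_injective : Function.Injective (toSeries D L) := by
  intro a b h
  refine Subtype.ext (Prod.ext ?_ h)
  apply FaithfulSMul.algebraMap_injective D L
  exact (algebraMap_toBase a).trans (h ▸ (algebraMap_toBase b).symm)

instance : IsDomain (powerSeriesPullback D L) := (toSeries_injective (D := D) (L := L)).isDomain

/-- A kernel element `X * g` need not be a multiple of `X` in the pullback, as `g` may not lift; its
square `X * (X * g ^ 2)` is. -/
theorem ker_toBase_le (p : Ideal (powerSeriesPullback D L)) [p.IsPrime] (h : ofXMul 1 ∈ p) :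
    RingHom.ker (toBase D L) ≤ p := by
  intro a ha
  have h0 : PowerSeries.constantCoeff (toSeries D L a) = 0 := by
    rw [← algebraMap_toBase, (RingHom.mem_ker).mp ha, map_zero]
  obtain ⟨g, hg⟩ := PowerSeries.X_dvd_iff.mpr h0
  apply Ideal.IsPrime.mem_of_pow_mem ‹_› 2
  have : a ^ 2 = ofXMul 1 * ofXMul (g ^ 2) := by
    apply toSeries_injective
    rw [map_pow, hg, map_mul, toSeries_ofXMul, toSeries_ofXMul]
    ring
  rw [this]
  exact p.mul_mem_right _ h

/-- Every nonzero series is a unit times `X ^ n`, so every nonzero element of the pullback divides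
`X ^ (n + 1)`; the extra `X` keeps the cofactor in the pullback. -/
theorem eq_bot_of_notMem (p : Ideal (powerSeriesPullback D L)) [p.IsPrime]
    (h : ofXMul 1 ∉ p) : p = ⊥ := by
  rw [eq_bot_iff]
  intro a ha
  by_contra ha0
  have ha1 : toSeries D L a ≠ 0 := fun h0 => ha0 (toSeries_injective (h0.trans (map_zero _).symm))
  obtain ⟨n, w, hw⟩ := IsDiscreteValuationRing.associated_pow_irreducible ha1
    (PowerSeries.X_prime (R := L)).irreducible
  apply h
  apply Ideal.IsPrime.mem_of_pow_mem ‹_› (n + 1)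
  have : (ofXMul 1 : powerSeriesPullback D L) ^ (n + 1) = a * ofXMul w := by
    apply toSeries_injective
    rw [map_pow, map_mul, toSeries_ofXMul, toSeries_ofXMul, mul_one, pow_succ, ← hw]
    ring
  rw [this]
  exact p.mul_mem_right _ ha

theorem ringKrullDim_eq [Nontrivial D] :
    ringKrullDim (powerSeriesPullback D L) = ringKrullDim D + 1 := by
  rw [← krullDim_zeroLocus_ker_of_surjective _ (toBase_surjective (D := D) (L := L))]
  refine krullDim_eq_add_one_of_forall_eq_or_mem _ (zeroLocus_ker_nonempty _) ⊥ ?_ ?_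
  · intro p hp
    refine bot_lt_iff_ne_bot.mpr fun h => ofXMul_one_ne_zero (D := D) (L := L) ?_
    have : ofXMul 1 ∈ p.asIdeal := hp (RingHom.mem_ker.mpr (toBase_ofXMul 1))
    rw [h] at this
    exact this
  · intro p hp
    apply PrimeSpectrum.ext
    exact eq_bot_of_notMem _ fun h => hp (ker_toBase_le _ h)

theorem ker_mapRingHom_toBase_le (p : Ideal (powerSeriesPullback D L)[X]) [p.IsPrime]
    (h : C (ofXMul 1) ∈ p) : RingHom.ker (mapRingHom (toBase D L)) ≤ p := by
  intro f hf
  refine Ideal.polynomial_mem_ideal_of_coeff_mem_ideal p f fun n => ?_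
  refine ker_toBase_le (p.comap C) h ?_
  have := congrArg (fun g => coeff g n) (RingHom.mem_ker.mp hf)
  simpa using this

/-- Primes containing `X` form a copy of Spec `D[X]`; all others contract to zero, so only zero lies
strictly below them. Evaluation at `s` supplies a nonzero prime below the whole copy. -/
theorem ringKrullDim_polynomial_eq [Nontrivial D] (s : L) (hs : Transcendental D s) :
    ringKrullDim (powerSeriesPullback D L)[X] = ringKrullDim D[X] + 2 := by
  have hsurj : Function.Surjective (mapRingHom (toBase D L)) :=
    Polynomial.map_surjective _ toBase_surjective
  rw [← krullDim_zeroLocus_ker_of_surjective _ hsurj]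
  let φ : (powerSeriesPullback D L)[X] →+* PowerSeries L :=
    eval₂RingHom (toSeries D L) (PowerSeries.C s)
  have htker : (C (ofXMul 1) : (powerSeriesPullback D L)[X]) ∈
      RingHom.ker (mapRingHom (toBase D L)) := by
    simp [RingHom.mem_ker]
  have htφ : (C (ofXMul 1) : (powerSeriesPullback D L)[X]) ∉ RingHom.ker φ := by
    simp [RingHom.mem_ker, φ, PowerSeries.X_ne_zero, toSeries_ofXMul]
  -- Taking constant terms turns `f(s) = 0` into a relation for `s` over `D`, which transcendence
  -- makes trivial.
  have hφ : RingHom.ker φ ≤ RingHom.ker (mapRingHom (toBase D L)) := by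
    intro f hf
    have h1 : PowerSeries.constantCoeff (eval₂ (toSeries D L) (PowerSeries.C s) f) = 0 := by
      rw [show eval₂ (toSeries D L) (PowerSeries.C s) f = 0 from hf, map_zero]
    have h2 : (PowerSeries.constantCoeff (R := L)).comp (toSeries D L) =
        (algebraMap D L).comp (toBase D L) :=
      RingHom.ext fun a => (algebraMap_toBase a).symm
    rw [hom_eval₂, h2, PowerSeries.constantCoeff_C, ← eval₂_map, ← aeval_def] at h1
    exact transcendental_iff.mp hs _ h1
  refine krullDim_eq_add_two_of_lt_of_lt _ (zeroLocus_ker_nonempty _)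
    (fun p q hpq hp => Set.Subset.trans hp hpq) ⊥ ⟨RingHom.ker φ, RingHom.ker_isPrime φ⟩ ?_
    (fun p => bot_le) ?_ ?_
  · refine bot_lt_iff_ne_bot.mpr fun h => ofXMul_one_ne_zero (D := D) (L := L) ?_
    -- A linear polynomial with root `s`; multiplying by the series variable brings its coefficients
    -- into the pullback.
    have hmem : (C (ofXMul 1) * X - C (ofXMul (PowerSeries.C s)) : (powerSeriesPullback D L)[X]) ∈
        RingHom.ker φ := by
      simp [RingHom.mem_ker, φ]
    have h' : RingHom.ker φ = ⊥ := congrArg PrimeSpectrum.asIdeal h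
    rw [h'] at hmem
    have := congrArg (fun g => coeff g 1) (show _ = (0 : (powerSeriesPullback D L)[X]) from hmem)
    simpa [coeff_C] using this
  · intro p hp
    refine lt_of_le_of_ne (hφ.trans hp) fun h => htφ ?_
    have h' : RingHom.ker φ = p.asIdeal := congrArg PrimeSpectrum.asIdeal h
    rw [h']
    exact hp htker
  · intro p q hq hpq
    refine eq_bot_of_lt_of_comap_C_eq_bot p q hpq (PrimeSpectrum.ext ?_)
    exact eq_bot_of_notMem (q.asIdeal.comap C) fun h => hq (ker_mapRingHom_toBase_le _ h)

end powerSeriesPullback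

end Pullback

/-! ### Seidenberg's examples -/

theorem exists_ringKrullDim_add_one_and_add_two (k : Type u) [Field k] (D : Type u) [CommRing D]
    [IsDomain D] [Algebra k D] :
    ∃ (A : Type u) (_ : CommRing A) (_ : IsDomain A) (_ : Algebra k A),
      ringKrullDim A = ringKrullDim D + 1 ∧ ringKrullDim A[X] = ringKrullDim D[X] + 2 := by
  let L := FractionRing D[X]
  have hinj : Function.Injective (algebraMap D L) := by
    rw [IsScalarTower.algebraMap_eq D D[X] L]
    exact (IsFractionRing.injective D[X] L).comp C_injective
  have : FaithfulSMul D L := (faithfulSMul_iff_algebraMap_injective D L).mpr hinj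
  have hs : Transcendental D (algebraMap D[X] L X) :=
    (transcendental_algebraMap_iff (IsFractionRing.injective D[X] L)).mpr
      (Polynomial.transcendental_X D)
  exact ⟨powerSeriesPullback D L, inferInstance, inferInstance,
    ((powerSeriesPullback.ofBase D L).comp (algebraMap k D)).toAlgebra,
    powerSeriesPullback.ringKrullDim_eq,
    powerSeriesPullback.ringKrullDim_polynomial_eq _ hs⟩

/-- Seidenberg's examples, as algebras over a given field. -/
theorem exists_ringKrullDim_eq_and_ringKrullDim_polynomial_eq (k : Type u) [Field k] (m j : ℕ) :
    ∃ (A : Type u) (_ : CommRing A) (_ : IsDomain A) (_ : Algebra k A),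
      ringKrullDim A = (m + j : ℕ) ∧ ringKrullDim A[X] = (m + 1 + 2 * j : ℕ) := by
  induction j with
  | zero =>
    have h : ringKrullDim (MvPolynomial (Fin m) k) = (m : ℕ) := by simp
    refine ⟨MvPolynomial (Fin m) k, inferInstance, inferInstance, inferInstance, h, ?_⟩
    rw [Polynomial.ringKrullDim_of_isNoetherianRing, h]
    rfl
  | succ j ih =>
    obtain ⟨D, _, _, _, h1, h2⟩ := ih
    obtain ⟨A, i1, i2, i3, h3, h4⟩ := exists_ringKrullDim_add_one_and_add_two k D
    refine ⟨A, i1, i2, i3, ?_, ?_⟩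
    · rw [h3, h1]
      rfl
    · rw [h4, h2]
      rfl

/-! ### Primes of `k ⊕ ⨁_{n > 0} A x ^ n` and of `A[X]` -/

noncomputable section ConstRing

variable {k : Type u} {A : Type v} [Field k] [CommRing A] [Algebra k A]

namespace constRing

variable (k) in
/-- The element `X * f` of `k ⊕ ⨁_{n > 0} A x ^ n`. -/
def xMul (f : A[X]) : constRing k A := ⟨X * f, 0, by simp⟩

@[simp]
theorem coe_xMul (f : A[X]) : (xMul k f : A[X]) = X * f := rfl

theorem xMul_mul_xMul (f g : A[X]) : xMul k f * xMul k g = xMul k 1 * xMul k (f * g) := by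
  apply Subtype.ext
  simp only [MulMemClass.coe_mul, coe_xMul]
  ring

theorem xMul_coe (r : constRing k A) : xMul k (r : A[X]) = xMul k 1 * r := by
  apply Subtype.ext
  simp only [MulMemClass.coe_mul, coe_xMul, mul_one]

variable (k A) in
/-- The constant coefficient. -/
def constCoeffHom : constRing k A →+* A :=
  Polynomial.constantCoeff.comp (constRing k A).val.toRingHom

@[simp]
theorem constCoeffHom_apply (f : constRing k A) : constCoeffHom k A f = (f : A[X]).coeff 0 := rfl

theorem ker_constCoeffHom_le (p : Ideal (constRing k A)) [p.IsPrime] (h : xMul k 1 ∈ p) :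
    RingHom.ker (constCoeffHom k A) ≤ p := by
  intro f hf
  have hf' : (f : A[X]).coeff 0 = 0 := hf
  obtain ⟨g, hg⟩ := X_dvd_iff.mpr hf'
  obtain rfl : f = xMul k g := Subtype.ext hg
  apply Ideal.IsPrime.mem_of_pow_mem ‹_› 2
  rw [sq, xMul_mul_xMul]
  exact p.mul_mem_right _ h

/-- Constant coefficients range over the field `k`, so the irrelevant ideal is maximal. -/
theorem eq_ker_constCoeffHom (p : Ideal (constRing k A)) [hp : p.IsPrime] (h : xMul k 1 ∈ p) :
    p = RingHom.ker (constCoeffHom k A) := by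
  refine le_antisymm (fun f hf => ?_) (ker_constCoeffHom_le p h)
  obtain ⟨c, hc⟩ := f.2
  have hfc : f - algebraMap k _ c ∈ p := ker_constCoeffHom_le p h <| by
    rw [RingHom.mem_ker, map_sub, constCoeffHom_apply, ← hc, sub_eq_zero]
    simp [Polynomial.algebraMap_apply]
  have hcp : algebraMap k _ c ∈ p := by simpa using p.sub_mem hf hfc
  have hc0 : c = 0 := by
    by_contra hc0
    exact hp.ne_top (p.eq_top_of_isUnit_mem hcp ((IsUnit.mk0 c hc0).map _))
  rw [RingHom.mem_ker, constCoeffHom_apply, ← hc, hc0, map_zero]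

/-- A prime of `k ⊕ ⨁_{n > 0} A x ^ n` not containing `x`, extended to `A[X]`. -/
def extend (p : Ideal (constRing k A)) [p.IsPrime] (h : xMul k 1 ∉ p) : PrimeSpectrum A[X] where
  asIdeal :=
    { carrier := {f | xMul k f ∈ p}
      add_mem' := fun {f g} hf hg => by
        have : xMul k (f + g) = xMul k f + xMul k g := Subtype.ext (mul_add _ _ _)
        simpa only [Set.mem_ofPred_eq, this] using p.add_mem hf hg
      zero_mem' := by
        have : xMul k (0 : A[X]) = 0 := Subtype.ext (mul_zero _)
        simp only [Set.mem_ofPred_eq, this, p.zero_mem]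
      smul_mem' := fun f g hg => by
        -- `x * (x f g) = (x f) * (x g)` lies in `p`, and `x` cancels.
        refine (Ideal.IsPrime.mem_or_mem ‹_› (x := xMul k 1) ?_).resolve_left h
        rw [smul_eq_mul, ← xMul_mul_xMul]
        exact p.mul_mem_left _ hg }
  isPrime :=
    { ne_top' := fun htop => h ((Ideal.eq_top_iff_one _).mp htop)
      mem_or_mem' := fun {f g} hfg => by
        apply Ideal.IsPrime.mem_or_mem ‹p.IsPrime›
        rw [xMul_mul_xMul]
        exact p.mul_mem_left _ hfg }

theorem mem_extend {p : Ideal (constRing k A)} [p.IsPrime] {h : xMul k 1 ∉ p} {f : A[X]} :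
    f ∈ (extend p h).asIdeal ↔ xMul k f ∈ p := Iff.rfl

/-- The extension contracts back to `p`, which makes extending strictly monotone. -/
theorem coe_mem_extend {p : Ideal (constRing k A)} [hp : p.IsPrime] {h : xMul k 1 ∉ p}
    {r : constRing k A} : (r : A[X]) ∈ (extend p h).asIdeal ↔ r ∈ p := by
  rw [mem_extend, xMul_coe, hp.mul_mem_iff_mem_or_mem, or_iff_right h]

theorem extend_le_extend {p q : Ideal (constRing k A)} [p.IsPrime] [q.IsPrime] (hpq : p ≤ q)
    (hp : xMul k 1 ∉ p) (hq : xMul k 1 ∉ q) : extend p hp ≤ extend q hq :=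
  fun _ hf => hpq hf

theorem extend_lt_extend {p q : Ideal (constRing k A)} [p.IsPrime] [q.IsPrime] (hpq : p < q)
    (hp : xMul k 1 ∉ p) (hq : xMul k 1 ∉ q) : extend p hp < extend q hq := by
  refine lt_of_le_not_ge (extend_le_extend hpq.le hp hq) fun h => hpq.not_ge fun r hr => ?_
  exact coe_mem_extend.mp (h (coe_mem_extend (h := hq).mpr hr))

theorem X_notMem_extend {p : Ideal (constRing k A)} [p.IsPrime] (h : xMul k 1 ∉ p) :
    X ∉ (extend p h).asIdeal := by
  have : (X : A[X]) = (xMul k 1 : constRing k A) := (mul_one X).symm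
  rw [this, coe_mem_extend]
  exact h

/-- The extension of a prime below the irrelevant ideal lies below a prime containing `X`. -/
theorem exists_extend_le [Nontrivial A] (p : Ideal (constRing k A)) [p.IsPrime]
    (h : xMul k 1 ∉ p) (hle : p ≤ RingHom.ker (constCoeffHom k A)) :
    ∃ Q : PrimeSpectrum A[X], X ∈ Q.asIdeal ∧ extend p h ≤ Q := by
  -- Otherwise the extension contains some `f` with constant term 1; this `f` lies in the subring,
  -- hence in `p`, yet not in the irrelevant ideal.
  have hne : (extend p h).asIdeal ⊔ Ideal.span {X} ≠ ⊤ := by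
    rw [Ne, Ideal.eq_top_iff_one, Submodule.mem_sup]
    rintro ⟨f, hf, g, hg, hfg⟩
    obtain ⟨g, rfl⟩ := Ideal.mem_span_singleton.mp hg
    have h0 : f.coeff 0 = 1 := by simpa using congrArg (fun f => coeff f 0) hfg
    have h1 : (⟨f, 1, by rw [h0, map_one]⟩ : constRing k A) ∈ p := coe_mem_extend.mp hf
    have h2 := RingHom.mem_ker.mp (hle h1)
    rw [constCoeffHom_apply, h0] at h2
    exact one_ne_zero h2
  obtain ⟨M, hM, hle'⟩ := Ideal.exists_le_maximal _ hne
  exact ⟨⟨M, hM.isPrime⟩, hle' (Ideal.mem_sup_right (Ideal.mem_span_singleton_self X)),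
    le_sup_left.trans hle'⟩

/-! ### Equality of the Krull dimensions -/

theorem comap_val_lt_comap_val {P Q : PrimeSpectrum A[X]} (hPQ : P < Q) (hQ : X ∉ Q.asIdeal) :
    P.comap (constRing k A).val.toRingHom < Q.comap (constRing k A).val.toRingHom := by
  refine lt_of_le_not_ge (Ideal.comap_mono hPQ.le) fun h => hPQ.not_ge fun f hf => ?_
  have h1 : xMul k f ∈ (Q.comap (constRing k A).val.toRingHom).asIdeal :=
    Q.asIdeal.mul_mem_left X hf
  have h2 : X * f ∈ P.asIdeal := h h1
  exact (P.isPrime.mem_or_mem h2).resolve_left fun hX => hQ (hPQ.le hX)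

theorem ringKrullDim_le [Nontrivial A] : ringKrullDim (constRing k A) ≤ ringKrullDim A[X] := by
  classical
  refine iSup_le fun s => ?_
  rcases Nat.eq_zero_or_pos s.length with h0 | h0
  · rw [h0]
    exact ringKrullDim_nonneg_of_nontrivial
  -- Only the last prime of the chain can contain `x`. If it does, `Q` takes its place, chosen above
  -- the extension of the penultimate prime.
  have hmax : ∀ i j, i < j → xMul k 1 ∉ (s i).asIdeal := by
    intro i j hij hi
    have hlt := s.strictMono hij
    refine hlt.ne (PrimeSpectrum.ext ?_)
    rw [eq_ker_constCoeffHom _ hi, ← eq_ker_constCoeffHom _ (hlt.le hi)]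
  obtain ⟨Q, hQ⟩ : ∃ Q : PrimeSpectrum A[X], ∀ i j, i < j → xMul k 1 ∈ (s j).asIdeal →
      ∀ hi : xMul k 1 ∉ (s i).asIdeal, extend _ hi < Q := by
    by_cases hl : xMul k 1 ∈ s.last.asIdeal
    · let i₀ : Fin (s.length + 1) := ⟨s.length - 1, by omega⟩
      have hi₀ : i₀ < Fin.last _ := Fin.lt_def.mpr (Nat.sub_lt h0 one_pos)
      have hx := hmax _ _ hi₀
      obtain ⟨Q, hXQ, hQ⟩ := exists_extend_le _ hx
        ((eq_ker_constCoeffHom _ hl) ▸ (s.strictMono hi₀).le)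
      refine ⟨Q, fun i j hij hj hi => lt_of_le_of_ne ((extend_le_extend ?_ _ _).trans hQ) ?_⟩
      · refine s.monotone (Fin.le_def.mpr ?_)
        have := Fin.lt_def.mp hij
        change (i : ℕ) ≤ s.length - 1
        omega
      · intro h
        exact X_notMem_extend hi (h ▸ hXQ)
    · exact ⟨extend _ hl, fun i j _ hj => absurd (s.monotone (Fin.le_last j) hj) hl⟩
  let t : LTSeries (PrimeSpectrum A[X]) := LTSeries.mk s.length
    (fun i => if hi : xMul k 1 ∈ (s i).asIdeal then Q else extend _ hi) fun i j hij => by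
      have hi := hmax i j hij
      by_cases hj : xMul k 1 ∈ (s j).asIdeal
      · simpa [hi, hj] using hQ i j hij hj hi
      · simpa [hi, hj] using extend_lt_extend (s.strictMono hij) hi hj
  exact Order.LTSeries.length_le_krullDim t

/-- A chain contracts strictly if its top avoids `X`. No prime contains both `X` and `X + 1`, so a
translation of the variable arranges this. -/
theorem le_ringKrullDim : ringKrullDim A[X] ≤ ringKrullDim (constRing k A) := by
  refine iSup_le fun s => ?_
  obtain ⟨σ, hσ⟩ : ∃ σ : A[X] ≃+* A[X], σ X ∉ s.last.asIdeal := by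
    by_cases hX : X ∈ s.last.asIdeal
    · refine ⟨(taylorEquiv (1 : A)).toRingEquiv, fun h => s.last.isPrime.ne_top ?_⟩
      rw [Ideal.eq_top_iff_one]
      have h1 : taylor (1 : A) X ∈ s.last.asIdeal := h
      simpa using s.last.asIdeal.sub_mem h1 hX
    · exact ⟨RingEquiv.refl _, hX⟩
  let t : LTSeries (PrimeSpectrum (constRing k A)) := LTSeries.mk s.length
    (fun i => ((s i).comap (σ : A[X] →+* A[X])).comap (constRing k A).val.toRingHom)
    fun i j hij => by
      refine comap_val_lt_comap_val ?_ fun h => hσ (s.monotone (Fin.le_last j) h)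
      refine lt_of_le_not_ge (Ideal.comap_mono (s.strictMono hij).le) fun h =>
        (s.strictMono hij).not_ge fun f hf => ?_
      have h1 : σ.symm f ∈ ((s j).comap (σ : A[X] →+* A[X])).asIdeal := by
        change σ (σ.symm f) ∈ (s j).asIdeal
        rwa [σ.apply_symm_apply]
      have h2 : σ (σ.symm f) ∈ (s i).asIdeal := h h1
      rwa [σ.apply_symm_apply] at h2
  exact Order.LTSeries.length_le_krullDim t

theorem ringKrullDim_eq [Nontrivial A] : ringKrullDim (constRing k A) = ringKrullDim A[X] :=
  ringKrullDim_le.antisymm le_ringKrullDim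

/-! ### Homogeneous primes and the graded dimension -/

theorem coe_decompose (f : constRing k A) (n : ℕ) :
    ((DirectSum.decompose (constGrading k A) f n : constRing k A) : A[X]) =
      monomial n ((f : A[X]).coeff n) := by
  obtain ⟨a, ha⟩ := (DirectSum.decompose (constGrading k A) f n).2
  have h := coeff_coeAddMonoidHom_constGrading (DirectSum.decompose (constGrading k A) f) n
  rw [show DirectSum.coeAddMonoidHom (constGrading k A)
    (DirectSum.decompose (constGrading k A) f) = f from DirectSum.Decomposition.left_inv f, ha,
    coeff_monomial_same] at h
  rw [ha, h]

/-- The homogeneous prime of `k ⊕ ⨁_{n > 0} A x ^ n` attached to a prime of `A`. -/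
def homogeneousPrime (q : PrimeSpectrum A) :
    {p : PrimeSpectrum (constRing k A) // p.asIdeal.IsHomogeneous (constGrading k A)} :=
  ⟨(⟨q.asIdeal.map C, Ideal.isPrime_map_C_of_isPrime⟩ :
    PrimeSpectrum A[X]).comap (constRing k A).val.toRingHom, by
    intro n f hf
    have hf' := Ideal.mem_map_C_iff.mp (show (f : A[X]) ∈ q.asIdeal.map C from hf)
    refine Ideal.mem_map_C_iff.mpr fun i => ?_
    change coeff ((DirectSum.decompose (constGrading k A) f n : constRing k A) : A[X]) i ∈ _
    rw [coe_decompose, coeff_monomial]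
    split_ifs
    · exact hf' n
    · exact zero_mem _⟩

theorem mem_homogeneousPrime {q : PrimeSpectrum A} {f : constRing k A} :
    f ∈ (homogeneousPrime q : {p : PrimeSpectrum (constRing k A) //
      p.asIdeal.IsHomogeneous (constGrading k A)}).1.asIdeal ↔
      ∀ n, (f : A[X]).coeff n ∈ q.asIdeal :=
  Ideal.mem_map_C_iff

theorem isHomogeneous_ker_constCoeffHom :
    (RingHom.ker (constCoeffHom k A)).IsHomogeneous (constGrading k A) := by
  intro n f hf
  have hf' : (f : A[X]).coeff 0 = 0 := hf
  rw [RingHom.mem_ker, constCoeffHom_apply, coe_decompose, coeff_monomial]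
  split_ifs with h
  · rw [h, hf']
  · rfl

/-- The homogeneous primes behave like Spec `A` with a top adjoined, the irrelevant ideal. -/
theorem gradedKrullDim_eq [IsDomain A] :
    gradedKrullDim (constGrading k A) = ringKrullDim A + 1 := by
  classical
  rw [gradedKrullDim, ringKrullDim, ← Order.krullDim_WithTop]
  have hker : xMul k 1 ∈ RingHom.ker (constCoeffHom k A) := by simp [RingHom.mem_ker]
  apply le_antisymm
  · refine Order.krullDim_le_of_strictMono (fun p => if hp : xMul k 1 ∈ p.1.asIdeal then ⊤ else
      (((extend _ hp).comap C : PrimeSpectrum A) : WithTop (PrimeSpectrum A))) fun p q hpq => ?_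
    have hle : p.1.asIdeal ≤ q.1.asIdeal := hpq.le
    by_cases hq : xMul k 1 ∈ q.1.asIdeal
    · have hp : xMul k 1 ∉ p.1.asIdeal := fun hp => by
        refine hpq.ne (Subtype.ext (PrimeSpectrum.ext ?_))
        rw [eq_ker_constCoeffHom _ hp, eq_ker_constCoeffHom _ hq]
      simp [hp, hq]
    · have hp : xMul k 1 ∉ p.1.asIdeal := fun hp => hq (hle hp)
      simp only [hp, hq, dite_false, WithTop.coe_lt_coe]
      refine lt_of_le_not_ge (Ideal.comap_mono (extend_le_extend hle hp hq)) fun h =>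
        hpq.not_ge fun f hf => ?_
      -- Membership is tested on the components `a x ^ n`; as the extensions avoid `X`, it depends
      -- only on `a`, hence on the contraction to `A`.
      have hmon : ∀ n, (X ^ n * C ((f : A[X]).coeff n) : A[X]) =
          (DirectSum.decompose (constGrading k A) f n : constRing k A) := fun n => by
        rw [coe_decompose, X_pow_mul_C, C_mul_X_pow_eq_monomial]
      rw [← DirectSum.sum_support_decompose (constGrading k A) f]
      refine Ideal.sum_mem _ fun n _ => coe_mem_extend (h := hp).mp ?_
      rw [← hmon]
      refine Ideal.mul_mem_left _ _ (h (?_ : C _ ∈ (extend _ hq).asIdeal))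
      have h1 : (X ^ n * C ((f : A[X]).coeff n) : A[X]) ∈ (extend _ hq).asIdeal := by
        rw [hmon, coe_mem_extend]
        exact q.2 n hf
      exact ((extend _ hq).isPrime.mem_or_mem h1).resolve_left fun h2 =>
        X_notMem_extend hq ((extend _ hq).isPrime.mem_of_pow_mem n h2)
  · refine Order.krullDim_le_of_strictMono
      (fun q : WithTop (PrimeSpectrum A) => q.recTopCoe
        ⟨⟨RingHom.ker (constCoeffHom k A), RingHom.ker_isPrime _⟩,
          isHomogeneous_ker_constCoeffHom⟩ homogeneousPrime) fun p q hpq => ?_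
    induction p with
    | top => simp at hpq
    | coe p =>
      induction q with
      | top =>
        change (homogeneousPrime p).1.asIdeal < RingHom.ker (constCoeffHom k A)
        refine lt_of_le_of_ne (fun f hf => ?_) fun h => ?_
        · rw [RingHom.mem_ker, constCoeffHom_apply]
          obtain ⟨c, hc⟩ := f.2
          have h0 := mem_homogeneousPrime.mp hf 0
          rw [← hc] at h0 ⊢
          by_contra hc0
          have hc1 : c ≠ 0 := fun h => hc0 (by rw [h, map_zero])
          exact p.isPrime.ne_top
            (p.asIdeal.eq_top_of_isUnit_mem h0 ((IsUnit.mk0 c hc1).map (algebraMap k A)))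
        · rw [← h] at hker
          refine p.isPrime.ne_top ((Ideal.eq_top_iff_one _).mpr ?_)
          simpa using mem_homogeneousPrime.mp hker 1
      | coe q =>
        rw [WithTop.coe_lt_coe] at hpq
        change (homogeneousPrime p).1.asIdeal < (homogeneousPrime q).1.asIdeal
        refine lt_of_le_not_ge (fun f hf => ?_) fun h => hpq.not_ge fun a ha => ?_
        · exact mem_homogeneousPrime.mpr fun n => hpq.le (mem_homogeneousPrime.mp hf n)
        · have h1 : xMul k (C a) ∈ (homogeneousPrime (k := k) q).1.asIdeal :=
            mem_homogeneousPrime.mpr fun n => by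
              rw [coe_xMul, X_mul_C, coeff_C_mul]
              exact Ideal.mul_mem_right _ _ ha
          simpa using mem_homogeneousPrime.mp (h h1) 1

/-! ### Failure of the Hilbert–Serre property and conclusion -/

/-- The degree 1 piece maps onto `A`, and a domain finite over a field is a field. -/
theorem isField_of_finite_constGrading_one [IsDomain A] (h : Module.Finite k (constGrading k A 1)) :
    IsField A := by
  let φ : constGrading k A 1 →ₗ[k] A :=
    { toFun := fun f => ((f : constRing k A) : A[X]).coeff 1
      map_add' := fun _ _ => rfl
      map_smul' := fun _ _ => rfl }
  have hφ : Function.Surjective φ := fun a =>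
    ⟨⟨⟨monomial 1 a, monomial_mem_constRing one_pos a⟩, a, rfl⟩, coeff_monomial_same 1 a⟩
  have := Module.Finite.of_surjective φ hφ
  exact isField_of_isIntegral_of_isField' (Field.toIsField k)

theorem bijective_algebraMap_constGrading_zero [Nontrivial A] :
    Function.Bijective (algebraMap k (constGrading k A 0)) := by
  constructor
  · intro a b hab
    have h : algebraMap k (constRing k A) a = algebraMap k (constRing k A) b :=
      congrArg (fun f : constGrading k A 0 => (f : constRing k A)) hab
    exact (algebraMap k (constRing k A)).injective h
  · rintro ⟨f, hf⟩
    obtain ⟨c, hc⟩ := mem_constGrading_zero.mp hf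
    exact ⟨c, Subtype.ext hc.symm⟩

end constRing

end ConstRing

theorem mainTheorem7 (k : Type u) [Field k] (d d' : ℕ) (hd : 1 ≤ d) (hd₁ : d + 2 ≤ d')
    (hd₂ : d' ≤ 2 * d + 1) :
    (∃ (A : Type u) (_ : CommRing A) (_ : IsDomain A) (_ : Algebra k A),
      ringKrullDim A = d ∧ ringKrullDim A[X] = d') ∧
    (∀ (A : Type v) [CommRing A] [IsDomain A] [Algebra k A],
      ringKrullDim A = d → ringKrullDim A[X] = d' →
      IsDomain (constRing k A) ∧
      Function.Bijective (algebraMap k (constGrading k A 0)) ∧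
      ¬ IsHilbertSerre (constGrading k A) ∧
      gradedKrullDim (constGrading k A) = d + 1 ∧
      ringKrullDim (constRing k A) = d' ∧
      gradedKrullDim (constGrading k A) < ringKrullDim (constRing k A)) := by
  constructor
  · obtain ⟨A, i1, i2, i3, h1, h2⟩ :=
      -- The solution of `m + j = d` and `m + 1 + 2 * j = d'`; the bounds on `d'` make both entries
      -- genuine natural numbers.
      exists_ringKrullDim_eq_and_ringKrullDim_polynomial_eq k (2 * d + 1 - d') (d' - d - 1)
    refine ⟨A, i1, i2, i3, ?_, ?_⟩
    · rw [h1]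
      congr 1
      omega
    · rw [h2]
      congr 1
      omega
  · intro A _ _ _ hA hAX
    have hg : gradedKrullDim (constGrading k A) = d + 1 := by
      rw [constRing.gradedKrullDim_eq, hA]
    have hr : ringKrullDim (constRing k A) = d' := by rw [constRing.ringKrullDim_eq, hAX]
    refine ⟨inferInstance, constRing.bijective_algebraMap_constGrading_zero, fun hHS => ?_,
      hg, hr, ?_⟩
    · have h0 := ringKrullDim_eq_zero_of_isField
        (constRing.isField_of_finite_constGrading_one (hHS.finite 1))
      rw [hA] at h0
      have : d = 0 := by exact_mod_cast h0
      omega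
    · rw [hg, hr]
      exact_mod_cast hd₁
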